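/- An $\ell$-group is a lattice-ordered group $G$, written additively and not necessarily Abelian; an $\ell$-homomorphism is a group homomorphism that is also a lattice homomorphism. A convex $\ell$-subgroup of $G$ is a subgroup that is an order-convex sublattice; an $\ell$-ideal is a normal convex $\ell$-subgroup. Denote by $\operatorname{Cs}_c G$ (resp. $\operatorname{Id}_c G$) the set of all finitely generated convex $\ell$-subgroups (resp. finitely generated $\ell$-ideals) of $G$, ordered by inclusion; for an $\ell$-homomorphism $f\colon G\to H$, the map $\operatorname{Cs}_c f$ (resp. $\operatorname{Id}_c f$) sends $S$ to the convex $\ell$-subgroup (resp. $\ell$-ideal) of $H$ generated by $f[S]$. The poset $\operatorname{Cs}_c G$ is a distributive lattice with zero, and so is $\operatorname{Id}_c G$ if $G$ is representable (i.e., a subdirect product of totally ordered groups), in particular if $G$ is Abelian, in which case $\operatorname{Cs}_cG=\operatorname{Id}_cG$. A $0$-lattice homomorphism is a lattice homomorphism that preserves $0$. Let $\mathfrak{P}[3]$ be the powerset of $\{1,2,3\}$, ordered by inclusion; write $12$ for $\{1,2\}$, and so on. Let $A_{123}$ be the Abelian $\ell$-group defined by the generators $a,a',b,c$ and the relations $0\le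 a\le a'\le 2a$, $0\le b$, $0\le c$. Let $A_{12}$, $A_{13}$, $A_{23}$, $A_1$, $A_2$, $A_3$ be the $\ell$-subgroups of $A_{123}$ generated by $\{a,b\}$, $\{a',c\}$, $\{b,c\}$, $\{a\}$, $\{b\}$, $\{c\}$, respectively, and let $A_\varnothing=\{0\}$. Let $\vec A$ be the (non-commutative) $\mathfrak{P}[3]$-indexed diagram with vertices $A_p$ whose only arrow from $A_p$ to $A_q$, for $p\subseteq q$, is the inclusion map, except that the only arrow from $A_1$ to $A_{13}$ is the $\ell$-homomorphism sending $a$ to $a'$, and that there are two arrows from $A_1$ to $A_{123}$, namely the inclusion map and the $\ell$-homomorphism sending $a$ to $a'$. Applying $\operatorname{Id}_c$ to the vertices and arrows of $\vec A$ yields a commutative diagram $\operatorname{Id}_c\vec A$ of distributive lattices with zero and $0$-lattice homomorphisms. **Theorem.** Let $\vec G=(G_p,\gamma_p^q\mid p\subseteq q\text{ in }\mathfrak{P}[3])$ be a commutative diagram of $\ell$-groups and $\ell$-homomorphisms. Let $\vec\eta=(\eta_p\mid p\in\mathfrak{P}[3])$ be a natural transformation, consisting of $0$-lattice homomorphisms,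 either 1. from $\operatorname{Cs}_c\vec G$ to $\operatorname{Id}_c\vec A$, or 2. from $\operatorname{Id}_c\vec G$ to $\operatorname{Id}_c\vec A$, in case all the $\ell$-groups $G_p$ are representable. Then $\eta_i=0$ for some $i\in\{1,2,3\}$. -/

import Mathlib

/-! ### Lattice-ordered groups, their homomorphisms, convex `ℓ`-subgroups and `ℓ`-ideals

An `ℓ`-group (written additively, not necessarily commutative) is a type with
`[AddGroup G] [Lattice G] [AddLeftMono G] [AddRightMono G]`. -/

/-- An `ℓ`-homomorphism: a group homomorphism that is also a lattice homomorphism. -/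
structure LGroupHom (G : Type*) (H : Type*) [AddGroup G] [Lattice G] [AddGroup H] [Lattice H]
    extends G →+ H where
  map_sup' : ∀ x y : G, toFun (x ⊔ y) = toFun x ⊔ toFun y
  map_inf' : ∀ x y : G, toFun (x ⊓ y) = toFun x ⊓ toFun y

section Ideals

variable {G : Type*} [AddGroup G] [Lattice G] {H : Type*} [AddGroup H] [Lattice H]

instance : CoeFun (LGroupHom G H) (fun _ => G → H) := ⟨fun f => f.toAddMonoidHom⟩

/-- A subgroup is an `ℓ`-subgroup if it is also a sublattice. -/
def IsLSubgroup (S : AddSubgroup G) : Prop :=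
  ∀ x ∈ S, ∀ y ∈ S, x ⊔ y ∈ S ∧ x ⊓ y ∈ S

/-- Convex `ℓ`-subgroups. -/
def IsConvexLSubgroup (S : AddSubgroup G) : Prop :=
  IsLSubgroup S ∧ (S : Set G).OrdConnected

/-- `ℓ`-ideals, that is, normal convex `ℓ`-subgroups. -/
def IsLIdeal (S : AddSubgroup G) : Prop :=
  IsConvexLSubgroup S ∧ S.Normal

/-- The `ℓ`-subgroup generated by a set. -/
def lClosure (X : Set G) : AddSubgroup G :=
  sInf {S | IsLSubgroup S ∧ X ⊆ S}

/-- The convex `ℓ`-subgroup generated by a set. -/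
def convexLClosure (X : Set G) : AddSubgroup G :=
  sInf {S | IsConvexLSubgroup S ∧ X ⊆ S}

/-- The `ℓ`-ideal generated by a set. -/
def lIdealClosure (X : Set G) : AddSubgroup G :=
  sInf {S | IsLIdeal S ∧ X ⊆ S}

lemma isLSubgroup_sInf {𝒮 : Set (AddSubgroup G)} (h : ∀ S ∈ 𝒮, IsLSubgroup S) :
    IsLSubgroup (sInf 𝒮) := by
  intro x hx y hy
  simp only [AddSubgroup.mem_sInf] at hx hy ⊢
  exact ⟨fun S hS => (h S hS x (hx S hS) y (hy S hS)).1,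
    fun S hS => (h S hS x (hx S hS) y (hy S hS)).2⟩

lemma isConvexLSubgroup_sInf {𝒮 : Set (AddSubgroup G)} (h : ∀ S ∈ 𝒮, IsConvexLSubgroup S) :
    IsConvexLSubgroup (sInf 𝒮) := by
  refine ⟨isLSubgroup_sInf fun S hS => (h S hS).1, ⟨fun x hx y hy z hz => ?_⟩⟩
  simp only [SetLike.mem_coe, AddSubgroup.mem_sInf] at hx hy ⊢
  exact fun S hS => (h S hS).2.out (hx S hS) (hy S hS) hz

lemma isLIdeal_sInf {𝒮 : Set (AddSubgroup G)} (h : ∀ S ∈ 𝒮, IsLIdeal S) :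
    IsLIdeal (sInf 𝒮) := by
  refine ⟨isConvexLSubgroup_sInf fun S hS => (h S hS).1, ⟨fun x hx g => ?_⟩⟩
  simp only [AddSubgroup.mem_sInf] at hx ⊢
  exact fun S hS => (h S hS).2.conj_mem x (hx S hS) g

lemma isLSubgroup_lClosure (X : Set G) : IsLSubgroup (lClosure X) :=
  isLSubgroup_sInf fun _ hS => hS.1

lemma isConvexLSubgroup_convexLClosure (X : Set G) : IsConvexLSubgroup (convexLClosure X) :=
  isConvexLSubgroup_sInf fun _ hS => hS.1

lemma isLIdeal_lIdealClosure (X : Set G) : IsLIdeal (lIdealClosure X) :=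
  isLIdeal_sInf fun _ hS => hS.1

lemma subset_lClosure (X : Set G) : X ⊆ lClosure X :=
  fun _ hx => AddSubgroup.mem_sInf.2 fun _ hS => hS.2 hx

lemma subset_convexLClosure (X : Set G) : X ⊆ convexLClosure X :=
  fun _ hx => AddSubgroup.mem_sInf.2 fun _ hS => hS.2 hx

lemma subset_lIdealClosure (X : Set G) : X ⊆ lIdealClosure X :=
  fun _ hx => AddSubgroup.mem_sInf.2 fun _ hS => hS.2 hx

lemma lClosure_le {X : Set G} {S : AddSubgroup G} (hS : IsLSubgroup S) (h : X ⊆ S) :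
    lClosure X ≤ S := sInf_le ⟨hS, h⟩

lemma convexLClosure_le {X : Set G} {S : AddSubgroup G} (hS : IsConvexLSubgroup S) (h : X ⊆ S) :
    convexLClosure X ≤ S := sInf_le ⟨hS, h⟩

lemma lIdealClosure_le {X : Set G} {S : AddSubgroup G} (hS : IsLIdeal S) (h : X ⊆ S) :
    lIdealClosure X ≤ S := sInf_le ⟨hS, h⟩

lemma LGroupHom.isLSubgroup_comap (f : LGroupHom G H) {S : AddSubgroup H} (hS : IsLSubgroup S) :
    IsLSubgroup (S.comap f.toAddMonoidHom) := by
  intro x hx y hy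
  refine ⟨?_, ?_⟩
  · change f.toFun (x ⊔ y) ∈ S
    rw [f.map_sup']
    exact (hS _ hx _ hy).1
  · change f.toFun (x ⊓ y) ∈ S
    rw [f.map_inf']
    exact (hS _ hx _ hy).2

lemma LGroupHom.mono (f : LGroupHom G H) {x y : G} (h : x ≤ y) : f x ≤ f y := by
  have := f.map_sup' x y
  rw [sup_eq_right.2 h] at this
  exact le_of_le_of_eq le_sup_left this.symm

lemma LGroupHom.isConvexLSubgroup_comap (f : LGroupHom G H) {S : AddSubgroup H}
    (hS : IsConvexLSubgroup S) : IsConvexLSubgroup (S.comap f.toAddMonoidHom) :=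
  ⟨f.isLSubgroup_comap hS.1,
    ⟨fun _ hx _ hy _ hz => hS.2.out hx hy ⟨f.mono hz.1, f.mono hz.2⟩⟩⟩

lemma LGroupHom.isLIdeal_comap (f : LGroupHom G H) {S : AddSubgroup H} (hS : IsLIdeal S) :
    IsLIdeal (S.comap f.toAddMonoidHom) :=
  ⟨f.isConvexLSubgroup_comap hS.1, hS.2.comap _⟩

lemma convexLClosure_image (f : LGroupHom G H) (X : Set G) :
    convexLClosure (f '' (convexLClosure X : Set G)) = convexLClosure (f '' X) := by
  apply le_antisymm
  · refine convexLClosure_le (isConvexLSubgroup_convexLClosure _) (Set.image_subset_iff.2 ?_)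
    exact convexLClosure_le (f.isConvexLSubgroup_comap (isConvexLSubgroup_convexLClosure _))
      (fun _ hx => subset_convexLClosure (f '' X) (Set.mem_image_of_mem f hx))
  · exact convexLClosure_le (isConvexLSubgroup_convexLClosure _)
      ((Set.image_mono (subset_convexLClosure X)).trans (subset_convexLClosure _))

lemma lIdealClosure_image (f : LGroupHom G H) (X : Set G) :
    lIdealClosure (f '' (lIdealClosure X : Set G)) = lIdealClosure (f '' X) := by
  apply le_antisymm
  · refine lIdealClosure_le (isLIdeal_lIdealClosure _) (Set.image_subset_iff.2 ?_)
    exact lIdealClosure_le (f.isLIdeal_comap (isLIdeal_lIdealClosure _))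
      (fun _ hx => subset_lIdealClosure (f '' X) (Set.mem_image_of_mem f hx))
  · exact lIdealClosure_le (isLIdeal_lIdealClosure _)
      ((Set.image_mono (subset_lIdealClosure X)).trans (subset_lIdealClosure _))

variable (G) in
/-- The finitely generated convex `ℓ`-subgroups of `G`, ordered by inclusion. -/
def Csc : Type _ := {S : AddSubgroup G // ∃ X : Set G, X.Finite ∧ S = convexLClosure X}

variable (G) in
/-- The finitely generated `ℓ`-ideals of `G`, ordered by inclusion. -/
def Idc : Type _ := {S : AddSubgroup G // ∃ X : Set G, X.Finite ∧ S = lIdealClosure X}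

instance : PartialOrder (Csc G) := Subtype.partialOrder _

instance : PartialOrder (Idc G) := Subtype.partialOrder _

lemma isLIdeal_bot : IsLIdeal (⊥ : AddSubgroup G) := by
  refine ⟨⟨?_, ⟨?_⟩⟩, inferInstance⟩
  · intro x hx y hy
    simp only [AddSubgroup.mem_bot] at *
    subst hx hy
    simp
  · intro x hx y hy z hz
    simp only [AddSubgroup.coe_bot, Set.mem_singleton_iff] at *
    subst hx hy
    exact le_antisymm hz.2 hz.1

/-- The zero of `Csc G` is the trivial subgroup. -/
instance : OrderBot (Csc G) where
  bot := ⟨⊥, ∅, Set.finite_empty,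
    (le_bot_iff.1 (convexLClosure_le isLIdeal_bot.1 (Set.empty_subset _))).symm⟩
  bot_le S := (bot_le : (⊥ : AddSubgroup G) ≤ S.1)

/-- The zero of `Idc G` is the trivial subgroup. -/
instance : OrderBot (Idc G) where
  bot := ⟨⊥, ∅, Set.finite_empty,
    (le_bot_iff.1 (lIdealClosure_le isLIdeal_bot (Set.empty_subset _))).symm⟩
  bot_le S := (bot_le : (⊥ : AddSubgroup G) ≤ S.1)

/-- The action of the functor `Csc` on `ℓ`-homomorphisms: `S` is sent to the convex
`ℓ`-subgroup generated by its image. -/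
def Csc.map (f : LGroupHom G H) (S : Csc G) : Csc H :=
  ⟨convexLClosure (f '' (S.1 : Set G)), by
    obtain ⟨X, hX, h⟩ := S.2
    exact ⟨f '' X, hX.image _, by rw [h, convexLClosure_image]⟩⟩

/-- The action of the functor `Idc` on `ℓ`-homomorphisms: `S` is sent to the
`ℓ`-ideal generated by its image. -/
def Idc.map (f : LGroupHom G H) (S : Idc G) : Idc H :=
  ⟨lIdealClosure (f '' (S.1 : Set G)), by
    obtain ⟨X, hX, h⟩ := S.2
    exact ⟨f '' X, hX.image _, by rw [h, lIdealClosure_image]⟩⟩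

end Ideals

/-- A map preserving the least element, binary joins and binary meets. -/
structure IsZeroLatticeHom {D E : Type*} [PartialOrder D] [OrderBot D] [PartialOrder E]
    [OrderBot E] (f : D → E) : Prop where
  map_bot : f ⊥ = ⊥
  map_join : ∀ x y z : D, IsLUB {x, y} z → IsLUB {f x, f y} (f z)
  map_meet : ∀ x y z : D, IsGLB {x, y} z → IsGLB {f x, f y} (f z)

/-- On lattices, `IsZeroLatticeHom` has its usual equational meaning. -/
lemma isZeroLatticeHom_iff {D E : Type*} [Lattice D] [OrderBot D] [Lattice E] [OrderBot E]
    (f : D → E) : IsZeroLatticeHom f ↔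
      f ⊥ = ⊥ ∧ (∀ x y, f (x ⊔ y) = f x ⊔ f y) ∧ (∀ x y, f (x ⊓ y) = f x ⊓ f y) := by
  constructor
  · rintro ⟨h0, h1, h2⟩
    exact ⟨h0, fun x y => (h1 x y _ isLUB_pair).unique isLUB_pair,
      fun x y => (h2 x y _ isGLB_pair).unique isGLB_pair⟩
  · rintro ⟨h0, h1, h2⟩
    refine ⟨h0, fun x y z h => ?_, fun x y z h => ?_⟩
    · rw [h.unique isLUB_pair, h1]
      exact isLUB_pair
    · rw [h.unique isGLB_pair, h2]
      exact isGLB_pair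

/-- An `ℓ`-group is representable if it is a subdirect product of totally ordered groups. -/
def IsRepresentable.{u} (G : Type u) [AddGroup G] [Lattice G] : Prop :=
  ∃ (I : Type u) (T : I → Type u) (_ : ∀ i, AddGroup (T i)) (_ : ∀ i, LinearOrder (T i))
    (f : ∀ i, LGroupHom G (T i)),
    (∀ i, AddLeftMono (T i) ∧ AddRightMono (T i)) ∧
    (∀ i, Function.Surjective (f i)) ∧
    ∀ x : G, (∀ i, f i x = 0) → x = 0

/-! ### Abelian `ℓ`-groups given by generators and relations -/

/-- Terms in the similarity type `(0, +, -, ⊔, ⊓)`. -/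
inductive LTerm (X : Type*) : Type _
  | var : X → LTerm X
  | zero : LTerm X
  | add : LTerm X → LTerm X → LTerm X
  | neg : LTerm X → LTerm X
  | sup : LTerm X → LTerm X → LTerm X
  | inf : LTerm X → LTerm X → LTerm X

/-- The least congruence on terms that contains the relations `R` and the axioms of
Abelian `ℓ`-groups. -/
inductive LTerm.Rel {X : Type*} (R : LTerm X → LTerm X → Prop) : LTerm X → LTerm X → Prop
  | of {s t : LTerm X} : R s t → LTerm.Rel R s t
  | refl (s : LTerm X) : LTerm.Rel R s s
  | symm {s t : LTerm X} : LTerm.Rel R s t → LTerm.Rel R t s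
  | trans {s t u : LTerm X} : LTerm.Rel R s t → LTerm.Rel R t u → LTerm.Rel R s u
  | add_congr {s s' t t' : LTerm X} : LTerm.Rel R s s' → LTerm.Rel R t t' →
      LTerm.Rel R (s.add t) (s'.add t')
  | neg_congr {s s' : LTerm X} : LTerm.Rel R s s' → LTerm.Rel R s.neg s'.neg
  | sup_congr {s s' t t' : LTerm X} : LTerm.Rel R s s' → LTerm.Rel R t t' →
      LTerm.Rel R (s.sup t) (s'.sup t')
  | inf_congr {s s' t t' : LTerm X} : LTerm.Rel R s s' → LTerm.Rel R t t' →
      LTerm.Rel R (s.inf t) (s'.inf t')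
  | add_assoc (s t u : LTerm X) : LTerm.Rel R ((s.add t).add u) (s.add (t.add u))
  | add_comm (s t : LTerm X) : LTerm.Rel R (s.add t) (t.add s)
  | zero_add (s : LTerm X) : LTerm.Rel R (LTerm.zero.add s) s
  | neg_add (s : LTerm X) : LTerm.Rel R (s.neg.add s) LTerm.zero
  | sup_comm (s t : LTerm X) : LTerm.Rel R (s.sup t) (t.sup s)
  | sup_assoc (s t u : LTerm X) : LTerm.Rel R ((s.sup t).sup u) (s.sup (t.sup u))
  | inf_comm (s t : LTerm X) : LTerm.Rel R (s.inf t) (t.inf s)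
  | inf_assoc (s t u : LTerm X) : LTerm.Rel R ((s.inf t).inf u) (s.inf (t.inf u))
  | sup_inf_self (s t : LTerm X) : LTerm.Rel R (s.sup (s.inf t)) s
  | inf_sup_self (s t : LTerm X) : LTerm.Rel R (s.inf (s.sup t)) s
  | add_sup (s t u : LTerm X) : LTerm.Rel R (s.add (t.sup u)) ((s.add t).sup (s.add u))

/-- The congruence `LTerm.Rel R` as a setoid. -/
def LTerm.setoid {X : Type*} (R : LTerm X → LTerm X → Prop) : Setoid (LTerm X) :=
  ⟨LTerm.Rel R, LTerm.Rel.refl, LTerm.Rel.symm, LTerm.Rel.trans⟩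

/-- The Abelian `ℓ`-group defined by the generators `X` and the relations `R`. -/
def PresentedLGroup {X : Type*} (R : LTerm X → LTerm X → Prop) : Type _ :=
  Quotient (LTerm.setoid R)

namespace PresentedLGroup

variable {X : Type*} {R : LTerm X → LTerm X → Prop}

/-- The canonical generators. -/
def of (x : X) : PresentedLGroup R := Quotient.mk (LTerm.setoid R) (LTerm.var x)

instance : AddCommGroup (PresentedLGroup R) where
  zero := Quotient.mk (LTerm.setoid R) LTerm.zero
  add := Quotient.map₂ LTerm.add (fun _ _ h _ _ h' => LTerm.Rel.add_congr h h')
  neg := Quotient.map LTerm.neg (fun _ _ h => LTerm.Rel.neg_congr h)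
  nsmul := @nsmulRec _ ⟨Quotient.mk (LTerm.setoid R) LTerm.zero⟩
    ⟨Quotient.map₂ LTerm.add (fun _ _ h _ _ h' => LTerm.Rel.add_congr h h')⟩
  zsmul := @zsmulRec _ ⟨Quotient.mk (LTerm.setoid R) LTerm.zero⟩
    ⟨Quotient.map₂ LTerm.add (fun _ _ h _ _ h' => LTerm.Rel.add_congr h h')⟩
    ⟨Quotient.map LTerm.neg (fun _ _ h => LTerm.Rel.neg_congr h)⟩
    (@nsmulRec _ ⟨Quotient.mk (LTerm.setoid R) LTerm.zero⟩
      ⟨Quotient.map₂ LTerm.add (fun _ _ h _ _ h' => LTerm.Rel.add_congr h h')⟩)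
  add_assoc := by
    rintro ⟨s⟩ ⟨t⟩ ⟨u⟩
    exact Quotient.sound (LTerm.Rel.add_assoc s t u)
  zero_add := by
    rintro ⟨s⟩
    exact Quotient.sound (LTerm.Rel.zero_add s)
  add_zero := by
    rintro ⟨s⟩
    exact Quotient.sound ((LTerm.Rel.add_comm _ _).trans (LTerm.Rel.zero_add s))
  neg_add_cancel := by
    rintro ⟨s⟩
    exact Quotient.sound (LTerm.Rel.neg_add s)
  add_comm := by
    rintro ⟨s⟩ ⟨t⟩
    exact Quotient.sound (LTerm.Rel.add_comm s t)

/-- The order is the one of the lattice operations: `x ≤ y ↔ x ⊔ y = y`. -/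
instance : Lattice (PresentedLGroup R) :=
  @Lattice.mk' _
    ⟨Quotient.map₂ LTerm.sup (fun _ _ h _ _ h' => LTerm.Rel.sup_congr h h')⟩
    ⟨Quotient.map₂ LTerm.inf (fun _ _ h _ _ h' => LTerm.Rel.inf_congr h h')⟩
    (by rintro ⟨s⟩ ⟨t⟩; exact Quotient.sound (LTerm.Rel.sup_comm s t))
    (by rintro ⟨s⟩ ⟨t⟩ ⟨u⟩; exact Quotient.sound (LTerm.Rel.sup_assoc s t u))
    (by rintro ⟨s⟩ ⟨t⟩; exact Quotient.sound (LTerm.Rel.inf_comm s t))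
    (by rintro ⟨s⟩ ⟨t⟩ ⟨u⟩; exact Quotient.sound (LTerm.Rel.inf_assoc s t u))
    (by rintro ⟨s⟩ ⟨t⟩; exact Quotient.sound (LTerm.Rel.sup_inf_self s t))
    (by rintro ⟨s⟩ ⟨t⟩; exact Quotient.sound (LTerm.Rel.inf_sup_self s t))

lemma add_sup_eq (x y z : PresentedLGroup R) : x + (y ⊔ z) = (x + y) ⊔ (x + z) := by
  obtain ⟨s⟩ := x
  obtain ⟨t⟩ := y
  obtain ⟨u⟩ := z
  exact Quotient.sound (LTerm.Rel.add_sup s t u)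

instance : IsOrderedAddMonoid (PresentedLGroup R) where
  add_le_add_left x y h z := by
    rw [← sup_eq_right] at h ⊢
    rw [add_comm x z, add_comm y z, ← add_sup_eq, h]

end PresentedLGroup

/-! ### The non-commutative diagram `A` -/

/-- The four generators `a`, `a'`, `b`, `c`. -/
inductive AGen : Type
  | a | a' | b | c

/-- The relations `0 ≤ a ≤ a' ≤ 2a`, `0 ≤ b`, `0 ≤ c`; here `s ≤ t` is written `s ⊓ t = s`. -/
inductive ARel : LTerm AGen → LTerm AGen → Prop
  | zero_le_a : ARel (LTerm.zero.inf (.var .a)) LTerm.zero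
  | a_le_a' : ARel (LTerm.inf (.var .a) (.var .a')) (.var .a)
  | a'_le_two_a : ARel (LTerm.inf (.var .a') (LTerm.add (.var .a) (.var .a))) (.var .a')
  | zero_le_b : ARel (LTerm.zero.inf (.var .b)) LTerm.zero
  | zero_le_c : ARel (LTerm.zero.inf (.var .c)) LTerm.zero

/-- The Abelian `ℓ`-group with generators `a, a', b, c` and relations
`0 ≤ a ≤ a' ≤ 2a`, `0 ≤ b`, `0 ≤ c`. -/
abbrev A123 : Type := PresentedLGroup ARel

/-- The image in `A123` of a generator. -/
abbrev A123.gen (x : AGen) : A123 := PresentedLGroup.of x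

/-- The generators of the vertices of the diagram. The cube is the powerset of `Fin 3`, ordered
by inclusion, where the elements `0, 1, 2` of `Fin 3` play the roles of `1, 2, 3`. -/
def vecAGen (p : Finset (Fin 3)) : Set A123 :=
  if p = ∅ then ∅
  else if p = {0} then {A123.gen .a}
  else if p = {1} then {A123.gen .b}
  else if p = {2} then {A123.gen .c}
  else if p = {0, 1} then {A123.gen .a, A123.gen .b}
  else if p = {0, 2} then {A123.gen .a', A123.gen .c}
  else if p = {1, 2} then {A123.gen .b, A123.gen .c}
  else Set.univ

/-- The vertices of the diagram, as `ℓ`-subgroups of `A123`. -/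
abbrev vecA (p : Finset (Fin 3)) : AddSubgroup A123 := lClosure (vecAGen p)

instance instLatticeLClosure {G : Type*} [AddGroup G] [Lattice G] (X : Set G) :
    Lattice (lClosure X) :=
  Subtype.lattice (fun _ _ hx hy => (isLSubgroup_lClosure X _ hx _ hy).1)
    (fun _ _ hx hy => (isLSubgroup_lClosure X _ hx _ hy).2)

/-- The sets of arrows of the diagram. All arrows from `p` to `q` are inclusion maps, except
that the only arrow from `{0}` to `{0, 2}` is the one that sends `a` to `a'`, and that there are
two arrows from `{0}` to `{0, 1, 2}`, the inclusion map and the map that sends `a` to `a'`. -/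
def vecAArrows (p q : Finset (Fin 3)) : Set (LGroupHom (vecA p) (vecA q)) :=
  {f | ¬ (p = {0} ∧ q = {0, 2}) ∧ ∀ x : vecA p, (f x : A123) = x} ∪
  {f | p = {0} ∧ (q = {0, 2} ∨ q = {0, 1, 2}) ∧
    ∀ x : vecA p, (x : A123) = A123.gen .a → (f x : A123) = A123.gen .a'}

/-!
A `0`-lattice homomorphism `η` composed with the principal ideal map turns joins of positive
elements into unions, and disjointness into disjointness, of open sets of `ℓ`-homomorphisms to the
reals. Suppose that `η i` is nonzero for every `i`, as witnessed by a positive `x i`. Pushed to the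
top vertex, `x 0`, `x 1`, `x 2` are supported where `a`, `b`, `c` do not vanish. By naturality,
whether `x i` exceeds `x j` at a real point of `A123` depends only on the two coordinates that
generate the vertex `{i, j}`: these are `(a, b)`, `(a', c)` and `(b, c)`.

In the quadrant of the values of `(a, b)`, the cones where `x 0 > x 1` and `x 1 > x 0` are open,
disjoint and contain one half-axis each, so by connectedness some ray `(1, b)` meets neither: there
`x 0` and `x 1` are equivalent. Hence comparing `x 0` with `x 2` amounts to comparing `x 1` with
`x 2`, regardless of the value of `a'` between `a` and `2a`. Taking `a' = 2a` and then `a' = a`, the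
slopes of the rays `(a', c)` along which `x 0 > x 2` are stable under doubling. They include all
small slopes, hence all slopes, although `x 2 > x 0` holds along all steep rays.
-/

/-! ### `ℓ`-homomorphisms and generated `ℓ`-subgroups -/

namespace LGroupHom

variable {G H K : Type*} [AddGroup G] [Lattice G] [AddGroup H] [Lattice H] [AddGroup K] [Lattice K]

lemma map_sup (f : LGroupHom G H) (x y : G) : f (x ⊔ y) = f x ⊔ f y := f.map_sup' x y

lemma map_inf (f : LGroupHom G H) (x y : G) : f (x ⊓ y) = f x ⊓ f y := f.map_inf' x y

lemma map_posPart (f : LGroupHom G H) (x : G) : f x⁺ = (f x)⁺ := by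
  rw [posPart_def, posPart_def, f.map_sup, map_zero]

lemma map_abs (f : LGroupHom G H) (x : G) : f |x| = |f x| := by
  rw [abs, abs, f.map_sup, map_neg]

@[ext]
lemma ext {f g : LGroupHom G H} (h : ∀ x, f x = g x) : f = g := by
  obtain ⟨f, _, _⟩ := f
  obtain ⟨g, _, _⟩ := g
  congr
  exact AddMonoidHom.ext h

/-- The composite of two `ℓ`-homomorphisms. -/
def comp (g : LGroupHom H K) (f : LGroupHom G H) : LGroupHom G K where
  toAddMonoidHom := g.toAddMonoidHom.comp f.toAddMonoidHom
  map_sup' x y := (congrArg g (f.map_sup x y)).trans (g.map_sup _ _)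
  map_inf' x y := (congrArg g (f.map_inf x y)).trans (g.map_inf _ _)

/-- The restriction of an `ℓ`-homomorphism to a generated `ℓ`-subgroup. -/
def domRestrict (f : LGroupHom G H) (X : Set G) : LGroupHom (lClosure X) H where
  toAddMonoidHom := f.toAddMonoidHom.comp (lClosure X).subtype
  map_sup' x y := f.map_sup x y
  map_inf' x y := f.map_inf x y

lemma isLSubgroup_eqLocus (f g : LGroupHom G H) :
    IsLSubgroup (f.toAddMonoidHom.eqLocus g.toAddMonoidHom) := fun x hx y hy =>
  ⟨(f.map_sup x y).trans ((congrArg₂ (· ⊔ ·) hx hy).trans (g.map_sup x y).symm),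
    (f.map_inf x y).trans ((congrArg₂ (· ⊓ ·) hx hy).trans (g.map_inf x y).symm)⟩

lemma eqOn_lClosure {f g : LGroupHom G H} {X : Set G} (h : Set.EqOn f g X) :
    Set.EqOn f g (lClosure X) :=
  lClosure_le (isLSubgroup_eqLocus f g) h

lemma domRestrict_congr {f g : LGroupHom G H} {X : Set G} (h : Set.EqOn f g X) :
    f.domRestrict X = g.domRestrict X := by
  ext x
  exact eqOn_lClosure h x.2

/-- The inclusion map between generated `ℓ`-subgroups. -/
def inclusion {X Y : Set G} (h : lClosure X ≤ lClosure Y) :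
    LGroupHom (lClosure X) (lClosure Y) where
  toAddMonoidHom := AddSubgroup.inclusion h
  map_sup' _ _ := rfl
  map_inf' _ _ := rfl

end LGroupHom

section lClosure

variable {G : Type*} [AddGroup G] [Lattice G] (X : Set G)

instance [AddLeftMono G] : AddLeftMono (lClosure X) :=
  ⟨fun z _ _ h => add_le_add_right (α := G) h (z : G)⟩

instance [AddRightMono G] : AddRightMono (lClosure X) :=
  ⟨fun z _ _ h => add_le_add_left (α := G) h (z : G)⟩

end lClosure

lemma lClosure_singleton_le_zmultiples {G : Type*} [AddCommGroup G] [Lattice G]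
    [IsOrderedAddMonoid G] {g : G} (hg : 0 ≤ g) :
    lClosure {g} ≤ AddSubgroup.zmultiples g := by
  refine lClosure_le ?_ (Set.singleton_subset_iff.2 (AddSubgroup.mem_zmultiples g))
  rintro _ ⟨m, rfl⟩ _ ⟨n, rfl⟩
  have hmono : Monotone fun k : ℤ => k • g := zsmul_left_mono hg
  exact ⟨⟨m ⊔ n, hmono.map_sup m n⟩, ⟨m ⊓ n, hmono.map_inf m n⟩⟩

/-! ### Evaluation of terms -/

section Presented

variable {X H : Type*} [AddCommGroup H] [Lattice H]

/-- The value of a term under an assignment of its variables. -/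
def LTerm.eval (v : X → H) : LTerm X → H
  | var x => v x
  | zero => 0
  | add s t => s.eval v + t.eval v
  | neg s => -s.eval v
  | sup s t => s.eval v ⊔ t.eval v
  | inf s t => s.eval v ⊓ t.eval v

variable {R : LTerm X → LTerm X → Prop} {v : X → H} [IsOrderedAddMonoid H]

lemma LTerm.Rel.eval_eq (hv : ∀ s t, R s t → s.eval v = t.eval v) {s t : LTerm X}
    (h : LTerm.Rel R s t) : s.eval v = t.eval v := by
  induction h with
  | of h => exact hv _ _ h
  | refl s => rfl
  | symm _ h => exact h.symm
  | trans _ _ h h' => exact h.trans h'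
  | add_congr _ _ h h' => exact congrArg₂ (· + ·) h h'
  | neg_congr _ h => exact congrArg (- ·) h
  | sup_congr _ _ h h' => exact congrArg₂ (· ⊔ ·) h h'
  | inf_congr _ _ h h' => exact congrArg₂ (· ⊓ ·) h h'
  | add_assoc s t u => exact _root_.add_assoc _ _ _
  | add_comm s t => exact _root_.add_comm _ _
  | zero_add s => exact _root_.zero_add _
  | neg_add s => exact neg_add_cancel _
  | sup_comm s t => exact _root_.sup_comm _ _
  | sup_assoc s t u => exact _root_.sup_assoc _ _ _
  | inf_comm s t => exact _root_.inf_comm _ _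
  | inf_assoc s t u => exact _root_.inf_assoc _ _ _
  | sup_inf_self s t => exact _root_.sup_inf_self
  | inf_sup_self s t => exact _root_.inf_sup_self
  | add_sup s t u => exact _root_.add_sup _ _ _

/-- The `ℓ`-homomorphism from a presented Abelian `ℓ`-group that extends an assignment of the
generators satisfying the relations. -/
def PresentedLGroup.lift (v : X → H) (hv : ∀ s t, R s t → s.eval v = t.eval v) :
    LGroupHom (PresentedLGroup R) H where
  toFun := Quotient.lift (LTerm.eval v) fun _ _ h => h.eval_eq hv
  map_zero' := rfl
  map_add' := by rintro ⟨s⟩ ⟨t⟩; rfl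
  map_sup' := by rintro ⟨s⟩ ⟨t⟩; rfl
  map_inf' := by rintro ⟨s⟩ ⟨t⟩; rfl

end Presented

/-! ### Principal convex `ℓ`-subgroups and `ℓ`-ideals -/

section Principal

variable {G : Type*} [AddGroup G] [Lattice G]

/-- The convex `ℓ`-subgroup generated by an element. -/
def Csc.principal (x : G) : Csc G := ⟨convexLClosure {x}, {x}, Set.finite_singleton x, rfl⟩

/-- The `ℓ`-ideal generated by an element. -/
def Idc.principal (x : G) : Idc G := ⟨lIdealClosure {x}, {x}, Set.finite_singleton x, rfl⟩

lemma Csc.isConvexLSubgroup (S : Csc G) : IsConvexLSubgroup S.1 := by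
  obtain ⟨X, _, h⟩ := S.2
  exact h ▸ isConvexLSubgroup_convexLClosure X

lemma Idc.isLIdeal (I : Idc G) : IsLIdeal I.1 := by
  obtain ⟨X, _, h⟩ := I.2
  exact h ▸ isLIdeal_lIdealClosure X

lemma Csc.principal_le_iff {x : G} {S : Csc G} : Csc.principal x ≤ S ↔ x ∈ S.1 :=
  ⟨fun h => h (subset_convexLClosure _ rfl),
    fun h => convexLClosure_le S.isConvexLSubgroup (Set.singleton_subset_iff.2 h)⟩

lemma Idc.principal_le_iff {x : G} {I : Idc G} : Idc.principal x ≤ I ↔ x ∈ I.1 :=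
  ⟨fun h => h (subset_lIdealClosure _ rfl),
    fun h => lIdealClosure_le I.isLIdeal (Set.singleton_subset_iff.2 h)⟩

lemma Csc.map_principal {H : Type*} [AddGroup H] [Lattice H] (f : LGroupHom G H) (x : G) :
    Csc.map f (Csc.principal x) = Csc.principal (f x) :=
  Subtype.ext ((convexLClosure_image f {x}).trans (by rw [Set.image_singleton]; rfl))

lemma Idc.map_principal {H : Type*} [AddGroup H] [Lattice H] (f : LGroupHom G H) (x : G) :
    Idc.map f (Idc.principal x) = Idc.principal (f x) :=
  Subtype.ext ((lIdealClosure_image f {x}).trans (by rw [Set.image_singleton]; rfl))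

variable [AddLeftMono G] [AddRightMono G]

namespace IsConvexLSubgroup

variable {S : AddSubgroup G}

lemma abs_mem_iff (hS : IsConvexLSubgroup S) {x : G} : |x| ∈ S ↔ x ∈ S :=
  ⟨fun h => hS.2.out (neg_mem h) h ⟨neg_le.2 (neg_le_abs x), le_abs_self x⟩,
    fun h => (hS.1 x h _ (neg_mem h)).1⟩

lemma add_mem_iff (hS : IsConvexLSubgroup S) {x y : G} (hx : 0 ≤ x) (hy : 0 ≤ y) :
    x + y ∈ S ↔ x ∈ S ∧ y ∈ S :=
  ⟨fun h => ⟨hS.2.out (zero_mem S) h ⟨hx, le_add_of_nonneg_right hy⟩,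
    hS.2.out (zero_mem S) h ⟨hy, le_add_of_nonneg_left hx⟩⟩, fun h => add_mem h.1 h.2⟩

end IsConvexLSubgroup

lemma exists_nonneg_forall_subset_iff_mem {X : Set G} (hX : X.Finite) :
    ∃ x : G, 0 ≤ x ∧ ∀ S : AddSubgroup G, IsConvexLSubgroup S → (X ⊆ S ↔ x ∈ S) := by
  induction X, hX using Set.Finite.induction_on with
  | empty => exact ⟨0, le_rfl, fun S _ => iff_of_true (Set.empty_subset _) (zero_mem S)⟩
  | @insert a X _ _ ih =>
    obtain ⟨x, hx, hX⟩ := ih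
    refine ⟨|a| + x, add_nonneg (abs_nonneg a) hx, fun S hS => ?_⟩
    rw [hS.add_mem_iff (abs_nonneg a) hx, hS.abs_mem_iff, ← hX S hS, Set.insert_subset_iff,
      SetLike.mem_coe]

lemma Csc.exists_nonneg_principal_eq (S : Csc G) : ∃ x : G, 0 ≤ x ∧ Csc.principal x = S := by
  obtain ⟨_, X, hX, rfl⟩ := S
  obtain ⟨x, hx, h⟩ := exists_nonneg_forall_subset_iff_mem hX
  have hcl := isConvexLSubgroup_convexLClosure (G := G)
  refine ⟨x, hx, Subtype.ext (le_antisymm (convexLClosure_le (hcl X) ?_)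
    (convexLClosure_le (hcl {x}) ?_))⟩
  · exact Set.singleton_subset_iff.2 ((h _ (hcl X)).1 (subset_convexLClosure X))
  · exact (h _ (hcl {x})).2 (subset_convexLClosure {x} rfl)

lemma Idc.exists_nonneg_principal_eq (I : Idc G) : ∃ x : G, 0 ≤ x ∧ Idc.principal x = I := by
  obtain ⟨_, X, hX, rfl⟩ := I
  obtain ⟨x, hx, h⟩ := exists_nonneg_forall_subset_iff_mem hX
  have hcl := isLIdeal_lIdealClosure (G := G)
  refine ⟨x, hx, Subtype.ext (le_antisymm (lIdealClosure_le (hcl X) ?_)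
    (lIdealClosure_le (hcl {x}) ?_))⟩
  · exact Set.singleton_subset_iff.2 ((h _ (hcl X).1).1 (subset_lIdealClosure X))
  · exact (h _ (hcl {x}).1).2 (subset_lIdealClosure {x} rfl)

lemma Csc.isLUB_principal_add {x y : G} (hx : 0 ≤ x) (hy : 0 ≤ y) :
    IsLUB {Csc.principal x, Csc.principal y} (Csc.principal (x + y)) :=
  isLUB_iff_le_iff.2 fun S => by
    simp [principal_le_iff, S.isConvexLSubgroup.add_mem_iff hx hy]

lemma Idc.isLUB_principal_add {x y : G} (hx : 0 ≤ x) (hy : 0 ≤ y) :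
    IsLUB {Idc.principal x, Idc.principal y} (Idc.principal (x + y)) :=
  isLUB_iff_le_iff.2 fun I => by
    simp [principal_le_iff, I.isLIdeal.1.add_mem_iff hx hy]

end Principal

/-! ### Polars -/

section Polar

lemma inf_eq_zero_of_le {α : Type*} [Lattice α] [Zero α] {x x' y : α} (hx : 0 ≤ x) (hxx' : x ≤ x')
    (h : x' ⊓ y = 0) : x ⊓ y = 0 :=
  le_antisymm ((inf_le_inf_right y hxx').trans h.le) (le_inf hx (h.symm.le.trans inf_le_right))

variable {G : Type*} [AddGroup G] [Lattice G] [AddLeftMono G] [AddRightMono G]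

lemma add_inf_eq_zero {x x' y : G} (hx : 0 ≤ x) (hx' : 0 ≤ x') (h : x ⊓ y = 0)
    (h' : x' ⊓ y = 0) : (x + x') ⊓ y = 0 := by
  have hy : 0 ≤ y := h.symm.le.trans inf_le_right
  have hle : (x + x') ⊓ y ≤ x := by
    calc (x + x') ⊓ y ≤ (x + x') ⊓ (x + y) :=
          inf_le_inf_left _ (le_add_of_nonneg_left hx)
      _ = x + x' ⊓ y := (add_inf _ _ _).symm
      _ = x := by rw [h', add_zero]
  refine le_antisymm ?_ (le_inf (add_nonneg hx hx') hy)
  exact (le_inf hle inf_le_right).trans h.le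

lemma abs_add_le_abs_add_abs_add_abs (x y : G) : |x + y| ≤ |x| + |y| + |x| := by
  refine abs_le'.2 ⟨?_, ?_⟩
  · exact (add_le_add (le_abs_self x) (le_abs_self y)).trans
      (le_add_of_nonneg_right (abs_nonneg x))
  · rw [neg_add_rev, add_assoc]
    exact (add_le_add (neg_le_abs y) (neg_le_abs x)).trans
      (le_add_of_nonneg_left (abs_nonneg x))

/-- The polar of an element: the subgroup of the elements disjoint from it. -/
def polar (y : G) : AddSubgroup G where
  carrier := {z | |z| ⊓ |y| = 0}
  zero_mem' := inf_eq_left.2 (abs_zero.trans_le (abs_nonneg y)) |>.trans abs_zero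
  add_mem' {u v} hu hv :=
    inf_eq_zero_of_le (abs_nonneg _) (abs_add_le_abs_add_abs_add_abs u v)
      (add_inf_eq_zero (add_nonneg (abs_nonneg u) (abs_nonneg v)) (abs_nonneg u)
        (add_inf_eq_zero (abs_nonneg u) (abs_nonneg v) hu hv) hu)
  neg_mem' {u} hu := (congrArg (· ⊓ |y|) (abs_neg u)).trans hu

lemma mem_polar {y z : G} : z ∈ polar y ↔ |z| ⊓ |y| = 0 := Iff.rfl

lemma mem_polar_comm {y z : G} : z ∈ polar y ↔ y ∈ polar z := by
  rw [mem_polar, mem_polar, inf_comm]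

lemma eq_zero_of_mem_polar_self {z : G} (h : z ∈ polar z) : z = 0 := by
  have habs : |z| ≤ 0 := (inf_idem |z|).symm.le.trans (le_of_eq h)
  exact le_antisymm ((le_abs_self z).trans habs) (neg_nonpos.1 ((neg_le_abs z).trans habs))

lemma abs_le_abs_add_abs {x y z : G} (hxz : x ⊓ y ≤ z) (hzy : z ≤ x ⊔ y) : |z| ≤ |x| + |y| := by
  have hx : |x| ≤ |x| + |y| := le_add_of_nonneg_right (abs_nonneg y)
  have hy : |y| ≤ |x| + |y| := le_add_of_nonneg_left (abs_nonneg x)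
  refine abs_le'.2 ⟨hzy.trans (sup_le ?_ ?_), neg_le.1 ((le_inf ?_ ?_).trans hxz)⟩
  · exact (le_abs_self x).trans hx
  · exact (le_abs_self y).trans hy
  · exact neg_le.1 ((neg_le_abs x).trans hx)
  · exact neg_le.1 ((neg_le_abs y).trans hy)

lemma isConvexLSubgroup_of_solid {S : AddSubgroup G} (h : ∀ x ∈ S, ∀ z, |z| ≤ |x| → z ∈ S) :
    IsConvexLSubgroup S := by
  have mem_of_between : ∀ x ∈ S, ∀ y ∈ S, ∀ z, x ⊓ y ≤ z → z ≤ x ⊔ y → z ∈ S := by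
    intro x hx y hy z hxz hzy
    have habs : ∀ x ∈ S, |x| ∈ S := fun x hx => h x hx _ (abs_abs x).le
    refine h _ (add_mem (habs x hx) (habs y hy)) z ?_
    exact (abs_le_abs_add_abs hxz hzy).trans (le_abs_self _)
  exact ⟨fun x hx y hy => ⟨mem_of_between x hx y hy _ inf_le_sup le_rfl,
      mem_of_between x hx y hy _ le_rfl inf_le_sup⟩,
    ⟨fun x hx y hy z hz => mem_of_between x hx y hy z (inf_le_left.trans hz.1)
      (hz.2.trans le_sup_right)⟩⟩

lemma isConvexLSubgroup_polar (y : G) : IsConvexLSubgroup (polar y) :=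
  isConvexLSubgroup_of_solid fun _ hx _ hz => inf_eq_zero_of_le (abs_nonneg _) hz hx

lemma IsRepresentable.isLIdeal_polar (hG : IsRepresentable G) (y : G) : IsLIdeal (polar y) := by
  obtain ⟨I, T, _, _, f, hT, -, hf⟩ := hG
  refine ⟨isConvexLSubgroup_polar y, ⟨fun z hz g => hf _ fun i => ?_⟩⟩
  have := (hT i).1
  have := (hT i).2
  have hzy : |f i z| ⊓ |f i y| = 0 := by
    rw [← LGroupHom.map_abs, ← LGroupHom.map_abs, ← LGroupHom.map_inf, mem_polar.1 hz, map_zero]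
  rw [LGroupHom.map_inf, LGroupHom.map_abs, LGroupHom.map_abs, map_add, map_add, map_neg]
  rcases min_choice |f i z| |f i y| with hmin | hmin <;>
    have h0 := abs_eq_zero.1 (hmin.symm.trans hzy)
  · rw [h0, add_zero, add_neg_cancel, abs_zero, inf_eq_left]
    exact abs_nonneg _
  · rw [h0, abs_zero, inf_eq_right]
    exact abs_nonneg _

lemma inf_eq_bot_of_le_polar {S T : AddSubgroup G} {x y : G}
    (hS : ∀ w, x ∈ polar w → S ≤ polar w) (hT : ∀ w, y ∈ polar w → T ≤ polar w)
    (hxy : x ∈ polar y) : S ⊓ T = ⊥ :=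
  (AddSubgroup.eq_bot_iff_forall _).2 fun z hz =>
    have hyz : y ∈ polar z := mem_polar_comm.1 (hS y hxy hz.1)
    eq_zero_of_mem_polar_self (hT z hyz hz.2)

lemma mem_polar_of_inf_eq_zero {x y : G} (h : x ⊓ y = 0) : x ∈ polar y := by
  rwa [mem_polar, abs_of_nonneg (h.symm.le.trans inf_le_left),
    abs_of_nonneg (h.symm.le.trans inf_le_right)]

end Polar

/-! ### Valuations -/

/-- A map that behaves on the positive cone like the principal ideal map followed by a
`0`-lattice homomorphism; the common setting of the two cases of the theorem. -/
structure IsLatticeValuation {G D : Type*} [AddGroup G] [Lattice G] [PartialOrder D] [OrderBot D]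
    (V : G → D) : Prop where
  isLUB_add {x y : G} : 0 ≤ x → 0 ≤ y → IsLUB {V x, V y} (V (x + y))
  isGLB_bot {x y : G} : x ⊓ y = 0 → IsGLB {V x, V y} ⊥

lemma IsZeroLatticeHom.comp_isLatticeValuation {G D E : Type*} [AddGroup G] [Lattice G]
    [PartialOrder D] [OrderBot D] [PartialOrder E] [OrderBot E] {η : D → E}
    (hη : IsZeroLatticeHom η) {V : G → D} (hV : IsLatticeValuation V) :
    IsLatticeValuation (fun x => η (V x)) where
  isLUB_add hx hy := hη.map_join _ _ _ (hV.isLUB_add hx hy)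
  isGLB_bot h := hη.map_bot ▸ hη.map_meet _ _ _ (hV.isGLB_bot h)

section Valuation

variable {G : Type*} [AddGroup G] [Lattice G] [AddLeftMono G] [AddRightMono G]

lemma Csc.isLatticeValuation_principal : IsLatticeValuation (Csc.principal (G := G)) where
  isLUB_add := Csc.isLUB_principal_add
  isGLB_bot {x y} h := by
    have principal_le_polar (u w : G) (hu : u ∈ polar w) : (principal u).1 ≤ polar w :=
      convexLClosure_le (isConvexLSubgroup_polar w) (Set.singleton_subset_iff.2 hu)
    have hbot := inf_eq_bot_of_le_polar (principal_le_polar x) (principal_le_polar y)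
      (mem_polar_of_inf_eq_zero h)
    exact ⟨fun _ _ => bot_le, fun S hS =>
      (le_inf (hS (Set.mem_insert _ _)) (hS (Set.mem_insert_of_mem _ rfl))).trans hbot.le⟩

lemma Idc.isLatticeValuation_principal (hG : IsRepresentable G) :
    IsLatticeValuation (Idc.principal (G := G)) where
  isLUB_add := Idc.isLUB_principal_add
  isGLB_bot {x y} h := by
    have principal_le_polar (u w : G) (hu : u ∈ polar w) : (principal u).1 ≤ polar w :=
      lIdealClosure_le (hG.isLIdeal_polar w) (Set.singleton_subset_iff.2 hu)
    have hbot := inf_eq_bot_of_le_polar (principal_le_polar x) (principal_le_polar y)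
      (mem_polar_of_inf_eq_zero h)
    exact ⟨fun _ _ => bot_le, fun I hI =>
      (le_inf (hI (Set.mem_insert _ _)) (hI (Set.mem_insert_of_mem _ rfl))).trans hbot.le⟩

end Valuation

/-! ### Supports -/

section Supp

variable {A B : Type*} [AddGroup A] [Lattice A] [AddGroup B] [Lattice B]

/-- The `ℓ`-homomorphisms to the reals that do not vanish on an ideal: the open set of the
(unnormalised) real spectrum associated with the ideal. -/
def Idc.supp (I : Idc A) : Set (LGroupHom A ℝ) := {φ | ∃ w ∈ I.1, φ w ≠ 0}

lemma LGroupHom.isLIdeal_ker (φ : LGroupHom A ℝ) : IsLIdeal φ.toAddMonoidHom.ker :=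
  φ.isLIdeal_comap isLIdeal_bot

lemma Idc.notMem_supp {I : Idc A} {φ : LGroupHom A ℝ} :
    φ ∉ I.supp ↔ I.1 ≤ φ.toAddMonoidHom.ker := by
  simp [supp, SetLike.le_def]

lemma Idc.mem_supp_principal {x : A} {φ : LGroupHom A ℝ} :
    φ ∈ (Idc.principal x).supp ↔ φ x ≠ 0 := by
  rw [← not_iff_not, notMem_supp, not_not]
  exact ⟨fun h => h (subset_lIdealClosure _ rfl),
    fun h => lIdealClosure_le φ.isLIdeal_ker (Set.singleton_subset_iff.2 h)⟩

lemma Idc.supp_mono {I J : Idc A} (h : I ≤ J) : I.supp ⊆ J.supp :=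
  fun _ ⟨w, hw, hφ⟩ => ⟨w, h hw, hφ⟩

lemma Idc.mem_supp_map {f : LGroupHom A B} {I : Idc A} {φ : LGroupHom B ℝ} :
    φ ∈ (Idc.map f I).supp ↔ φ.comp f ∈ I.supp := by
  rw [← not_iff_not, notMem_supp, notMem_supp]
  exact ⟨fun h w hw => h (subset_lIdealClosure _ (Set.mem_image_of_mem f hw)),
    fun h => lIdealClosure_le φ.isLIdeal_ker (Set.image_subset_iff.2 h)⟩

variable [AddLeftMono A] [AddRightMono A]

lemma Idc.supp_subset_union {I J K : Idc A} (h : IsLUB {I, J} K) : K.supp ⊆ I.supp ∪ J.supp := by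
  obtain ⟨x, hx, rfl⟩ := I.exists_nonneg_principal_eq
  obtain ⟨y, hy, rfl⟩ := J.exists_nonneg_principal_eq
  rw [h.unique (isLUB_principal_add hx hy)]
  intro φ hφ
  simp only [Set.mem_union, mem_supp_principal, map_add] at hφ ⊢
  by_contra! h0
  exact hφ (by rw [h0.1, h0.2, add_zero])

lemma Idc.disjoint_supp {I J : Idc A} (h : IsGLB {I, J} ⊥) : Disjoint I.supp J.supp := by
  rw [Set.disjoint_left]
  rintro φ ⟨x, hx, hφx⟩ ⟨y, hy, hφy⟩
  have abs_inf_abs_mem (K : Idc A) (z : A) (hz : z ∈ K.1) (hxyz : |x| ⊓ |y| ≤ |z|) :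
      |x| ⊓ |y| ∈ K.1 :=
    K.isLIdeal.1.2.out (zero_mem _) (K.isLIdeal.1.abs_mem_iff.2 hz)
      ⟨le_inf (abs_nonneg x) (abs_nonneg y), hxyz⟩
  have hlb : principal (|x| ⊓ |y|) ∈ lowerBounds {I, J} := by
    rintro K (rfl | rfl)
    · exact principal_le_iff.2 (abs_inf_abs_mem _ x hx inf_le_left)
    · exact principal_le_iff.2 (abs_inf_abs_mem _ y hy inf_le_right)
  have hzero : |x| ⊓ |y| = 0 := AddSubgroup.mem_bot.1 (principal_le_iff.1 (h.2 hlb))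
  have hpos : 0 < |φ x| ⊓ |φ y| := lt_min (abs_pos.2 hφx) (abs_pos.2 hφy)
  rw [← φ.map_abs, ← φ.map_abs, ← φ.map_inf, hzero, map_zero] at hpos
  exact hpos.false

end Supp

section Differences

variable {G : Type*} [AddGroup G] [Lattice G] [AddLeftMono G] [AddRightMono G]

lemma posPart_sub_le (x y z : G) : (x - z)⁺ ≤ (x - y)⁺ + (y - z)⁺ := by
  refine sup_le ?_ (add_nonneg (posPart_nonneg _) (posPart_nonneg _))
  rw [← sub_add_sub_cancel x y z]
  exact add_le_add (le_posPart _) (le_posPart _)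

lemma posPart_sub_inf_posPart_sub (x y : G) : (x - y)⁺ ⊓ (y - x)⁺ = 0 := by
  rw [← neg_sub x y, posPart_neg, posPart_inf_negPart_eq_zero]

end Differences

namespace IsLatticeValuation

variable {G : Type*} [AddGroup G] [Lattice G] [AddRightMono G]

lemma mono {D : Type*} [PartialOrder D] [OrderBot D] {V : G → D} (hV : IsLatticeValuation V)
    {x y : G} (hx : 0 ≤ x) (hxy : x ≤ y) : V x ≤ V y := by
  have hle := (hV.isLUB_add (sub_nonneg.2 hxy) hx).1 (Set.mem_insert_of_mem _ rfl)
  rwa [sub_add_cancel] at hle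

variable {A : Type*} [AddGroup A] [Lattice A] [AddLeftMono A] [AddRightMono A] {V : G → Idc A}

lemma supp_subset_union_of_le_add (hV : IsLatticeValuation V) {x y z : G} (hx : 0 ≤ x)
    (hy : 0 ≤ y) (hz : 0 ≤ z) (h : x ≤ y + z) : (V x).supp ⊆ (V y).supp ∪ (V z).supp :=
  (Idc.supp_mono (hV.mono hx h)).trans (Idc.supp_subset_union (hV.isLUB_add hy hz))

lemma supp_subset_union_posPart_sub (hV : IsLatticeValuation V) {x y : G} (hx : 0 ≤ x)
    (hy : 0 ≤ y) : (V x).supp ⊆ (V (x - y)⁺).supp ∪ (V y).supp :=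
  hV.supp_subset_union_of_le_add hx (posPart_nonneg _) hy (sub_le_iff_le_add.1 (le_posPart _))

variable [AddLeftMono G]

lemma supp_posPart_sub_subset_union (hV : IsLatticeValuation V) (x y z : G) :
    (V (x - z)⁺).supp ⊆ (V (x - y)⁺).supp ∪ (V (y - z)⁺).supp :=
  hV.supp_subset_union_of_le_add (posPart_nonneg _) (posPart_nonneg _) (posPart_nonneg _)
    (posPart_sub_le x y z)

lemma disjoint_supp_posPart_sub (hV : IsLatticeValuation V) (x y : G) :
    Disjoint (V (x - y)⁺).supp (V (y - x)⁺).supp :=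
  Idc.disjoint_supp (hV.isGLB_bot (posPart_sub_inf_posPart_sub x y))

end IsLatticeValuation

/-! ### Separating the two axes of a quadrant -/

section Planar

open scoped NNReal
open Filter Topology

/-- An open subset of the closed quadrant that is stable under multiplication by positive reals. -/
structure IsOpenCone (U : Set (ℝ≥0 × ℝ≥0)) : Prop where
  isOpen : IsOpen U
  smul_mem : ∀ z ∈ U, ∀ r : ℝ≥0, 0 < r → r • z ∈ U

lemma IsOpenCone.isOpen_slice {U : Set (ℝ≥0 × ℝ≥0)} (hU : IsOpenCone U) :
    IsOpen {t : ℝ≥0 | (1, t) ∈ U} :=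
  hU.isOpen.preimage (Continuous.prodMk_right 1)

/-- Disjoint open cones `U` and `V` of the closed quadrant that contain the first and the second
positive half-axis, respectively. -/
structure AxisSeparation (U V : Set (ℝ≥0 × ℝ≥0)) : Prop where
  left : IsOpenCone U
  right : IsOpenCone V
  disjoint : Disjoint U V
  left_axis : (1, 0) ∈ U
  right_axis : (0, 1) ∈ V

namespace AxisSeparation

variable {U V : Set (ℝ≥0 × ℝ≥0)}

lemma exists_mem_right (h : AxisSeparation U V) : ∃ t, (1, t) ∈ V := by
  have hV : ∀ᶠ s in 𝓝 (0 : ℝ≥0), (s, (1 : ℝ≥0)) ∈ V :=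
    (Continuous.prodMk_left (1 : ℝ≥0)).continuousAt (h.right.isOpen.mem_nhds h.right_axis)
  obtain ⟨s, hs, hs0⟩ := ((hV.filter_mono nhdsWithin_le_nhds).and
    (self_mem_nhdsWithin : Set.Ioi (0 : ℝ≥0) ∈ 𝓝[>] 0)).exists
  refine ⟨s⁻¹, ?_⟩
  have := h.right.smul_mem _ hs s⁻¹ (inv_pos.2 hs0)
  rwa [Prod.smul_mk, smul_eq_mul, smul_eq_mul, mul_one, inv_mul_cancel₀ (ne_of_gt hs0)] at this

lemma exists_gap (h : AxisSeparation U V) : ∃ t, (1, t) ∉ U ∧ (1, t) ∉ V := by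
  by_contra! hcover
  obtain ⟨t, ht⟩ := h.exists_mem_right
  obtain ⟨s, -, hsU, hsV⟩ := isPreconnected_univ {s : ℝ≥0 | (1, s) ∈ U} {s : ℝ≥0 | (1, s) ∈ V}
    h.left.isOpen_slice h.right.isOpen_slice
    (fun s _ => or_iff_not_imp_left.2 (hcover s)) ⟨0, trivial, h.left_axis⟩ ⟨t, trivial, ht⟩
  exact Set.disjoint_left.1 h.disjoint hsU hsV

/-- The slice of `U` at abscissa `1` is a neighbourhood of `0`; once it is closed under doubling
it is everything. -/
lemma false_of_doubling (h : AxisSeparation U V) (hdouble : ∀ t, (1, t) ∈ U → (1, 2 * t) ∈ U) :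
    False := by
  obtain ⟨t, ht⟩ := h.exists_mem_right
  have hlim : Tendsto (fun n : ℕ => t / 2 ^ n) atTop (𝓝 0) := by
    simpa [div_eq_mul_inv] using
      (NNReal.tendsto_pow_atTop_nhds_zero_of_lt_one two_inv_lt_one).const_mul t
  obtain ⟨n, hn⟩ := (hlim.eventually (h.left.isOpen_slice.mem_nhds h.left_axis)).exists
  have key : ∀ n : ℕ, (1, t / 2 ^ n) ∈ U → (1, t) ∈ U := by
    intro n
    induction n with
    | zero => simp only [pow_zero, div_one, imp_self]
    | succ n ih =>
      intro hn
      refine ih ?_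
      simpa only [pow_succ', mul_div_assoc', mul_div_mul_left _ _ (two_ne_zero' ℝ≥0)]
        using hdouble _ hn
  exact Set.disjoint_left.1 h.disjoint (key n hn) ht

lemma not_transitive {U₁₂ U₂₁ U₁₃ U₃₁ U₂₃ : Set (ℝ≥0 × ℝ≥0)} (h₁₂ : AxisSeparation U₁₂ U₂₁)
    (h₁₃ : AxisSeparation U₁₃ U₃₁)
    (trans₁₃ : ∀ a a' b c : ℝ≥0, a ≤ a' → a' ≤ 2 * a →
      (a', c) ∈ U₁₃ → (a, b) ∈ U₁₂ ∨ (b, c) ∈ U₂₃)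
    (trans₂₃ : ∀ a a' b c : ℝ≥0, a ≤ a' → a' ≤ 2 * a →
      (b, c) ∈ U₂₃ → (a, b) ∈ U₂₁ ∨ (a', c) ∈ U₁₃) : False := by
  obtain ⟨b, hb₁₂, hb₂₁⟩ := h₁₂.exists_gap
  refine h₁₃.false_of_doubling fun c hc => ?_
  have hc₁₃ : (2, 2 * c) ∈ U₁₃ := by
    simpa only [Prod.smul_mk, smul_eq_mul, mul_one] using h₁₃.left.smul_mem _ hc 2 two_pos
  have hbc : (b, 2 * c) ∈ U₂₃ :=
    (trans₁₃ 1 2 b (2 * c) one_le_two (mul_one 2).ge hc₁₃).resolve_left hb₁₂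
  exact (trans₂₃ 1 1 b (2 * c) le_rfl (by norm_num) hbc).resolve_left hb₂₁

end AxisSeparation

end Planar

/-! ### Real points of `A123` -/

section Points

open scoped NNReal

/-- Continuous positively homogeneous functions on the closed quadrant. -/
structure IsConic (f : ℝ≥0 × ℝ≥0 → ℝ) : Prop where
  continuous : Continuous f
  map_smul : ∀ (r : ℝ≥0) (z : ℝ≥0 × ℝ≥0), f (r • z) = r * f z

lemma isConic_zero : IsConic fun _ => (0 : ℝ≥0) :=
  ⟨continuous_const, fun r _ => (mul_zero (r : ℝ)).symm⟩

lemma isConic_fst : IsConic fun z => z.1 :=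
  ⟨NNReal.continuous_coe.comp continuous_fst, fun _ _ => NNReal.coe_mul _ _⟩

lemma isConic_snd : IsConic fun z => z.2 :=
  ⟨NNReal.continuous_coe.comp continuous_snd, fun _ _ => NNReal.coe_mul _ _⟩

lemma LTerm.isConic_eval {X : Type*} {v : ℝ≥0 × ℝ≥0 → X → ℝ} (hv : ∀ x, IsConic fun z => v z x)
    (t : LTerm X) : IsConic fun z => t.eval (v z) := by
  induction t with
  | var x => exact hv x
  | zero => exact isConic_zero
  | add s t hs ht =>
    exact ⟨hs.continuous.add ht.continuous, fun r z => by
      simp only [eval, hs.map_smul, ht.map_smul, mul_add]⟩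
  | neg s hs => exact ⟨hs.continuous.neg, fun r z => by simp only [eval, hs.map_smul, mul_neg]⟩
  | sup s t hs ht =>
    exact ⟨hs.continuous.sup ht.continuous, fun r z => by
      simp only [eval, hs.map_smul, ht.map_smul]
      exact (mul_max_of_nonneg _ _ r.2).symm⟩
  | inf s t hs ht =>
    exact ⟨hs.continuous.inf ht.continuous, fun r z => by
      simp only [eval, hs.map_smul, ht.map_smul]
      exact (mul_min_of_nonneg _ _ r.2).symm⟩

lemma isOpenCone_supp {A : Type*} [AddGroup A] [Lattice A] {σ : ℝ≥0 × ℝ≥0 → LGroupHom A ℝ}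
    (hσ : ∀ w, IsConic fun z => σ z w) (I : Idc A) : IsOpenCone {z | σ z ∈ I.supp} where
  isOpen := by
    have : {z | σ z ∈ I.supp} = ⋃ w ∈ I.1, {z | σ z w ≠ 0} := by ext; simp [Idc.supp]
    rw [this]
    exact isOpen_biUnion fun w _ => isOpen_ne.preimage (hσ w).continuous
  smul_mem := by
    rintro z ⟨w, hw, hz⟩ r hr
    exact ⟨w, hw, ((hσ w).map_smul r z).trans_ne (mul_ne_zero (NNReal.coe_ne_zero.2 hr.ne') hz)⟩

lemma IsLatticeValuation.axisSeparation {G A : Type*} [AddGroup G] [Lattice G] [AddLeftMono G]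
    [AddRightMono G] [AddGroup A] [Lattice A] [AddLeftMono A] [AddRightMono A] {V : G → Idc A}
    (hV : IsLatticeValuation V) {x y : G} (hx : 0 ≤ x) (hy : 0 ≤ y)
    {σ : ℝ≥0 × ℝ≥0 → LGroupHom A ℝ} (hσ : ∀ w, IsConic fun z => σ z w)
    (hσx : ∀ z, σ z ∈ (V x).supp ↔ z.1 ≠ 0) (hσy : ∀ z, σ z ∈ (V y).supp ↔ z.2 ≠ 0) :
    AxisSeparation {z | σ z ∈ (V (x - y)⁺).supp} {z | σ z ∈ (V (y - x)⁺).supp} where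
  left := isOpenCone_supp hσ _
  right := isOpenCone_supp hσ _
  disjoint := (hV.disjoint_supp_posPart_sub x y).preimage σ
  left_axis := (hV.supp_subset_union_posPart_sub hx hy ((hσx _).2 one_ne_zero)).resolve_right
    fun h => (hσy _).1 h rfl
  right_axis := (hV.supp_subset_union_posPart_sub hy hx ((hσy _).2 one_ne_zero)).resolve_right
    fun h => (hσx _).1 h rfl

/-- The assignments of the generators that satisfy the defining relations of `A123`. -/
structure IsAdmissible {H : Type*} [AddGroup H] [Lattice H] (v : AGen → H) : Prop where
  zero_le_a : 0 ≤ v .a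
  a_le_a' : v .a ≤ v .a'
  a'_le_two_a : v .a' ≤ v .a + v .a
  zero_le_b : 0 ≤ v .b
  zero_le_c : 0 ≤ v .c

namespace A123

/-- The `ℓ`-homomorphism from `A123` that extends an admissible assignment of the generators. -/
def lift {H : Type*} [AddCommGroup H] [Lattice H] [IsOrderedAddMonoid H] (v : AGen → H)
    (hv : IsAdmissible v) : LGroupHom A123 H :=
  PresentedLGroup.lift v fun s t h => by
    cases h with
    | zero_le_a => exact inf_eq_left.2 hv.zero_le_a
    | a_le_a' => exact inf_eq_left.2 hv.a_le_a'
    | a'_le_two_a => exact inf_eq_left.2 hv.a'_le_two_a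
    | zero_le_b => exact inf_eq_left.2 hv.zero_le_b
    | zero_le_c => exact inf_eq_left.2 hv.zero_le_c

lemma isAdmissible_gen : IsAdmissible gen where
  zero_le_a := inf_eq_left.1 (Quotient.sound (.of .zero_le_a))
  a_le_a' := inf_eq_left.1 (Quotient.sound (.of .a_le_a'))
  a'_le_two_a := inf_eq_left.1 (Quotient.sound (.of .a'_le_two_a))
  zero_le_b := inf_eq_left.1 (Quotient.sound (.of .zero_le_b))
  zero_le_c := inf_eq_left.1 (Quotient.sound (.of .zero_le_c))

lemma gen_nonneg (x : AGen) : 0 ≤ gen x := by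
  cases x with
  | a => exact isAdmissible_gen.zero_le_a
  | a' => exact isAdmissible_gen.zero_le_a.trans isAdmissible_gen.a_le_a'
  | b => exact isAdmissible_gen.zero_le_b
  | c => exact isAdmissible_gen.zero_le_c

/-- The `ℓ`-homomorphism from `A123` to the reals with given values at the generators. -/
def eval (a a' b c : ℝ≥0) (haa' : a ≤ a') (ha'a : a' ≤ 2 * a) : LGroupHom A123 ℝ :=
  lift (fun | .a => a | .a' => a' | .b => b | .c => c)
    { zero_le_a := a.2
      a_le_a' := haa'
      a'_le_two_a := by exact_mod_cast ha'a.trans_eq (two_mul a)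
      zero_le_b := b.2
      zero_le_c := c.2 }

lemma isConic_eval {a a' b c : ℝ≥0 × ℝ≥0 → ℝ≥0} (ha : IsConic fun z => a z)
    (ha' : IsConic fun z => a' z) (hb : IsConic fun z => b z) (hc : IsConic fun z => c z)
    (haa' : ∀ z, a z ≤ a' z) (ha'a : ∀ z, a' z ≤ 2 * a z) (w : A123) :
    IsConic fun z => eval (a z) (a' z) (b z) (c z) (haa' z) (ha'a z) w := by
  obtain ⟨t⟩ := w
  refine LTerm.isConic_eval (fun x => ?_) t
  cases x <;> assumption

end A123

end Points

/-! ### The diagram chase -/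

lemma vecAGen_zero : vecAGen {0} = {A123.gen .a} := by simp [vecAGen]

lemma vecAGen_one : vecAGen {1} = {A123.gen .b} := by simp [vecAGen]

lemma vecAGen_two : vecAGen {2} = {A123.gen .c} := by simp [vecAGen]

lemma vecAGen_zero_one : vecAGen {0, 1} = {A123.gen .a, A123.gen .b} := by
  simp +decide only [vecAGen, if_false, if_true]

lemma vecAGen_zero_two : vecAGen {0, 2} = {A123.gen .a', A123.gen .c} := by
  simp +decide only [vecAGen, if_false, if_true]

lemma vecAGen_one_two : vecAGen {1, 2} = {A123.gen .b, A123.gen .c} := by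
  simp +decide only [vecAGen, if_false, if_true]

lemma vecAGen_univ : vecAGen Finset.univ = Set.univ := by
  simp +decide only [vecAGen, if_false]

lemma vecA_le_vecA_univ (p : Finset (Fin 3)) : vecA p ≤ vecA Finset.univ :=
  fun _ _ => subset_lClosure _ (vecAGen_univ ▸ Set.mem_univ _)

lemma inclusion_mem_vecAArrows_univ (p : Finset (Fin 3)) :
    LGroupHom.inclusion (vecA_le_vecA_univ p) ∈ vecAArrows p Finset.univ :=
  Or.inl ⟨fun h => absurd h.2 (by decide), fun _ => rfl⟩

lemma Idc.mem_supp_of_singleton {A : Type*} [AddCommGroup A] [Lattice A] [IsOrderedAddMonoid A]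
    {w : A} (hw : 0 ≤ w) {X : Set A} (hX : X = {w}) {I : Idc (lClosure X)} (hI : I ≠ ⊥)
    {φ : LGroupHom (lClosure X) ℝ} :
    φ ∈ I.supp ↔ φ ⟨w, hX ▸ subset_lClosure {w} rfl⟩ ≠ 0 := by
  subst hX
  set g : lClosure {w} := ⟨w, subset_lClosure _ rfl⟩
  have exists_zsmul (u : lClosure {w}) : ∃ n : ℤ, n • g = u := by
    obtain ⟨n, hn⟩ := lClosure_singleton_le_zmultiples hw u.2
    exact ⟨n, Subtype.ext hn⟩
  constructor
  · rintro ⟨u, -, hu⟩ hg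
    obtain ⟨n, rfl⟩ := exists_zsmul u
    exact hu (by rw [map_zsmul, hg, smul_zero])
  · intro hg
    obtain ⟨u, hu, hu0⟩ : ∃ u ∈ I.1, u ≠ 0 := by
      by_contra! h
      exact hI (Subtype.ext ((AddSubgroup.eq_bot_iff_forall _).2 h))
    obtain ⟨n, rfl⟩ := exists_zsmul u
    refine ⟨n • g, hu, ?_⟩
    rw [map_zsmul]
    exact smul_ne_zero (left_ne_zero_of_smul hu0) hg

section Chase

open scoped NNReal

variable {G : Finset (Fin 3) → Type*} [∀ p, AddGroup (G p)] [∀ p, Lattice (G p)]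

/-- Naturality, with respect to the inclusion maps into the top vertex, of a family of maps from a
cube of `ℓ`-groups to `Idc` of the vertices of the diagram `A`. -/
def IsNaturalIntoTop (γ : ∀ p q : Finset (Fin 3), p ≤ q → LGroupHom (G p) (G q))
    (V : ∀ p, G p → Idc (vecA p)) : Prop :=
  ∀ (p : Finset (Fin 3)) (x : G p), V Finset.univ (γ p Finset.univ p.subset_univ x) =
    Idc.map (LGroupHom.inclusion (vecA_le_vecA_univ p)) (V p x)

/-- The real points of `A123` at which the image of `x i` in the top vertex exceeds that of `x j`,
as measured by the valuation `V Finset.univ`. -/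
def exceedSet (γ : ∀ p q : Finset (Fin 3), p ≤ q → LGroupHom (G p) (G q))
    (V : ∀ p, G p → Idc (vecA p)) (x : ∀ i : Fin 3, G {i}) (i j : Fin 3) :
    Set (LGroupHom A123 ℝ) :=
  {φ | φ.domRestrict (vecAGen Finset.univ) ∈
    (V Finset.univ (γ {i} Finset.univ (Finset.subset_univ _) (x i) -
      γ {j} Finset.univ (Finset.subset_univ _) (x j))⁺).supp}

variable {γ : ∀ p q : Finset (Fin 3), p ≤ q → LGroupHom (G p) (G q)}
  {V : ∀ p, G p → Idc (vecA p)} {x : ∀ i : Fin 3, G {i}} {i j : Fin 3}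

lemma IsNaturalIntoTop.domRestrict_mem_supp (hnat : IsNaturalIntoTop γ V) {p : Finset (Fin 3)}
    {u : G p} {φ : LGroupHom A123 ℝ} :
    φ.domRestrict (vecAGen Finset.univ) ∈ (V _ (γ p Finset.univ p.subset_univ u)).supp ↔
      φ.domRestrict (vecAGen p) ∈ (V p u).supp := by
  rw [hnat, Idc.mem_supp_map]
  rfl

lemma IsNaturalIntoTop.domRestrict_mem_supp_of_singleton (hnat : IsNaturalIntoTop γ V)
    {g : AGen} (hi : vecAGen {i} = {A123.gen g}) (hx : V {i} (x i) ≠ ⊥) {φ : LGroupHom A123 ℝ} :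
    φ.domRestrict (vecAGen Finset.univ) ∈
        (V _ (γ {i} Finset.univ (Finset.subset_univ _) (x i))).supp ↔ φ (A123.gen g) ≠ 0 := by
  rw [hnat.domRestrict_mem_supp, Idc.mem_supp_of_singleton (A123.gen_nonneg g) hi hx]
  rfl

lemma IsNaturalIntoTop.mem_exceedSet_congr (hnat : IsNaturalIntoTop γ V)
    (γ_comp : ∀ (p q r : Finset (Fin 3)) (hpq : p ≤ q) (hqr : q ≤ r) (x : G p),
      γ p r (hpq.trans hqr) x = γ q r hqr (γ p q hpq x))
    {p : Finset (Fin 3)} (hi : {i} ≤ p) (hj : {j} ≤ p) {φ ψ : LGroupHom A123 ℝ}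
    (h : Set.EqOn φ ψ (vecAGen p)) : φ ∈ exceedSet γ V x i j ↔ ψ ∈ exceedSet γ V x i j := by
  have hdiff : (γ {i} Finset.univ (Finset.subset_univ _) (x i) -
      γ {j} Finset.univ (Finset.subset_univ _) (x j))⁺ =
      γ p Finset.univ p.subset_univ (γ {i} p hi (x i) - γ {j} p hj (x j))⁺ := by
    rw [LGroupHom.map_posPart, map_sub, ← γ_comp, ← γ_comp]
  rw [exceedSet, hdiff, Set.mem_ofPred_eq, Set.mem_ofPred_eq, hnat.domRestrict_mem_supp,
    hnat.domRestrict_mem_supp, LGroupHom.domRestrict_congr h]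

variable [∀ p, AddLeftMono (G p)] [∀ p, AddRightMono (G p)]

lemma exceedSet_subset_union (hV : IsLatticeValuation (V Finset.univ)) (i j k : Fin 3) :
    exceedSet γ V x i k ⊆ exceedSet γ V x i j ∪ exceedSet γ V x j k :=
  fun _ hφ => hV.supp_posPart_sub_subset_union _ _ _ hφ

lemma IsNaturalIntoTop.axisSeparation (hnat : IsNaturalIntoTop γ V)
    (hV : IsLatticeValuation (V Finset.univ)) (hx : ∀ i, 0 ≤ x i) (hne : ∀ i, V {i} (x i) ≠ ⊥)
    {g h : AGen} (hi : vecAGen {i} = {A123.gen g}) (hj : vecAGen {j} = {A123.gen h})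
    {σ : ℝ≥0 × ℝ≥0 → LGroupHom A123 ℝ} (hσ : ∀ w, IsConic fun z => σ z w)
    (hσg : ∀ z, σ z (A123.gen g) = z.1) (hσh : ∀ z, σ z (A123.gen h) = z.2) :
    AxisSeparation {z | σ z ∈ exceedSet γ V x i j} {z | σ z ∈ exceedSet γ V x j i} := by
  have γ_nonneg (l : Fin 3) : 0 ≤ γ {l} Finset.univ (Finset.subset_univ _) (x l) :=
    (map_zero _).symm.trans_le ((γ _ _ _).mono (hx l))
  refine hV.axisSeparation (γ_nonneg i) (γ_nonneg j) (fun w => hσ w) (fun z => ?_) fun z => ?_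
  · rw [hnat.domRestrict_mem_supp_of_singleton hi (hne i), hσg, NNReal.coe_ne_zero]
  · rw [hnat.domRestrict_mem_supp_of_singleton hj (hne j), hσh, NNReal.coe_ne_zero]

/-- The point of the facet `a' = a`, `c = 0` with coordinates `a` and `b`. -/
def A123.evalAB (z : ℝ≥0 × ℝ≥0) : LGroupHom A123 ℝ :=
  eval z.1 z.1 z.2 0 le_rfl (le_mul_of_one_le_left' one_le_two)

/-- The point of the facet `a = a'`, `b = 0` with coordinates `a'` and `c`. -/
def A123.evalAC (z : ℝ≥0 × ℝ≥0) : LGroupHom A123 ℝ :=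
  eval z.1 z.1 0 z.2 le_rfl (le_mul_of_one_le_left' one_le_two)

/-- The point of the facet `a = a' = 0` with coordinates `b` and `c`. -/
def A123.evalBC (z : ℝ≥0 × ℝ≥0) : LGroupHom A123 ℝ :=
  eval 0 0 z.1 z.2 le_rfl zero_le

lemma A123.eqOn_eval_evalAB {a a' : ℝ≥0} (b c : ℝ≥0) (haa' : a ≤ a') (ha'a : a' ≤ 2 * a) :
    Set.EqOn (eval a a' b c haa' ha'a) (evalAB (a, b)) (vecAGen {0, 1}) := by
  rw [vecAGen_zero_one]
  rintro _ (rfl | rfl) <;> rfl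

lemma A123.eqOn_eval_evalAC {a a' : ℝ≥0} (b c : ℝ≥0) (haa' : a ≤ a') (ha'a : a' ≤ 2 * a) :
    Set.EqOn (eval a a' b c haa' ha'a) (evalAC (a', c)) (vecAGen {0, 2}) := by
  rw [vecAGen_zero_two]
  rintro _ (rfl | rfl) <;> rfl

lemma A123.eqOn_eval_evalBC {a a' : ℝ≥0} (b c : ℝ≥0) (haa' : a ≤ a') (ha'a : a' ≤ 2 * a) :
    Set.EqOn (eval a a' b c haa' ha'a) (evalBC (b, c)) (vecAGen {1, 2}) := by
  rw [vecAGen_one_two]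
  rintro _ (rfl | rfl) <;> rfl

theorem theorem5p13_general
    (γ_comp : ∀ (p q r : Finset (Fin 3)) (hpq : p ≤ q) (hqr : q ≤ r) (x : G p),
      γ p r (hpq.trans hqr) x = γ q r hqr (γ p q hpq x))
    (hV : IsLatticeValuation (V Finset.univ)) (hnat : IsNaturalIntoTop γ V) :
    ∃ i : Fin 3, ∀ x : G {i}, 0 ≤ x → V {i} x = ⊥ := by
  by_contra! hne
  choose x hx hne using hne
  have sep_AB := hnat.axisSeparation hV hx hne vecAGen_zero vecAGen_one (σ := A123.evalAB)
    (A123.isConic_eval isConic_fst isConic_fst isConic_snd isConic_zero _ _)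
    (fun _ => rfl) (fun _ => rfl)
  have sep_AC := hnat.axisSeparation hV hx hne vecAGen_zero vecAGen_two (σ := A123.evalAC)
    (A123.isConic_eval isConic_fst isConic_fst isConic_zero isConic_snd _ _)
    (fun _ => rfl) (fun _ => rfl)
  refine sep_AB.not_transitive sep_AC (U₂₃ := {z | A123.evalBC z ∈ exceedSet γ V x 1 2})
    (fun a a' b c haa' ha'a h => ?_) fun a a' b c haa' ha'a h => ?_
  all_goals
    have on_AB := A123.eqOn_eval_evalAB b c haa' ha'a
    have on_AC := A123.eqOn_eval_evalAC b c haa' ha'a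
    have on_BC := A123.eqOn_eval_evalBC b c haa' ha'a
  · refine (exceedSet_subset_union hV 0 1 2 ((hnat.mem_exceedSet_congr γ_comp ?_ ?_ on_AC).2 h)).imp
      (hnat.mem_exceedSet_congr γ_comp ?_ ?_ on_AB).1
      (hnat.mem_exceedSet_congr γ_comp ?_ ?_ on_BC).1 <;> decide
  · refine (exceedSet_subset_union hV 1 0 2 ((hnat.mem_exceedSet_congr γ_comp ?_ ?_ on_BC).2 h)).imp
      (hnat.mem_exceedSet_congr γ_comp ?_ ?_ on_AB).1
      (hnat.mem_exceedSet_congr γ_comp ?_ ?_ on_AC).1 <;> decide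

end Chase

theorem theorem5p13 {G : Finset (Fin 3) → Type*} [∀ p, AddGroup (G p)] [∀ p, Lattice (G p)]
    [∀ p, AddLeftMono (G p)] [∀ p, AddRightMono (G p)]
    (γ : ∀ p q : Finset (Fin 3), p ≤ q → LGroupHom (G p) (G q))
    (γ_id : ∀ (p : Finset (Fin 3)) (x : G p), γ p p le_rfl x = x)
    (γ_comp : ∀ (p q r : Finset (Fin 3)) (hpq : p ≤ q) (hqr : q ≤ r) (x : G p),
      γ p r (hpq.trans hqr) x = γ q r hqr (γ p q hpq x)) :
    (∀ η : ∀ p, Csc (G p) → Idc (vecA p),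
      (∀ p, IsZeroLatticeHom (η p)) →
      (∀ (p q : Finset (Fin 3)) (hpq : p ≤ q), ∀ f ∈ vecAArrows p q, ∀ x : Csc (G p),
        η q (Csc.map (γ p q hpq) x) = Idc.map f (η p x)) →
      ∃ i : Fin 3, ∀ x : Csc (G {i}), η {i} x = ⊥) ∧
    ((∀ p, IsRepresentable (G p)) →
      ∀ η : ∀ p, Idc (G p) → Idc (vecA p),
      (∀ p, IsZeroLatticeHom (η p)) →
      (∀ (p q : Finset (Fin 3)) (hpq : p ≤ q), ∀ f ∈ vecAArrows p q, ∀ x : Idc (G p),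
        η q (Idc.map (γ p q hpq) x) = Idc.map f (η p x)) →
      ∃ i : Fin 3, ∀ x : Idc (G {i}), η {i} x = ⊥) := by
  constructor
  · intro η hη hnat
    obtain ⟨i, hi⟩ := theorem5p13_general (V := fun p x => η p (Csc.principal x)) γ_comp
      ((hη _).comp_isLatticeValuation Csc.isLatticeValuation_principal)
      fun p x => (congrArg (η _) (Csc.map_principal _ x)).symm.trans
        (hnat p _ _ _ (inclusion_mem_vecAArrows_univ p) _)
    refine ⟨i, fun S => ?_⟩
    obtain ⟨x, hx, rfl⟩ := S.exists_nonneg_principal_eq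
    exact hi x hx
  · intro hG η hη hnat
    obtain ⟨i, hi⟩ := theorem5p13_general (V := fun p x => η p (Idc.principal x)) γ_comp
      ((hη _).comp_isLatticeValuation (Idc.isLatticeValuation_principal (hG _)))
      fun p x => (congrArg (η _) (Idc.map_principal _ x)).symm.trans
        (hnat p _ _ _ (inclusion_mem_vecAArrows_univ p) _)
    refine ⟨i, fun S => ?_⟩
    obtain ⟨x, hx, rfl⟩ := S.exists_nonneg_principal_eq
    exact hi x hx
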